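/- **Setting.** A *Cantor action* $(\mathfrak X,G,\Phi)$ is a minimal equicontinuous action by homeomorphisms of a countably infinite group $G$ on a Cantor space $\mathfrak X$ (a non-empty compact metrizable, totally disconnected, perfect space). Two such actions $(\mathfrak X,G,\Phi)$, $(\mathfrak X',G,\Psi)$ are *conjugate* if there is a homeomorphism $h\colon\mathfrak X\to\mathfrak X'$ with $h\circ\Phi(g)=\Psi(g)\circ h$ for all $g\in G$. A set $U\subset\mathfrak X$ is *adapted* if it is non-empty and clopen and $gU\cap U\neq\emptyset$ implies $gU=U$. An *adapted neighborhood basis* at $x\in\mathfrak X$ is a properly descending sequence $\mathcal U=\{\mathfrak X=U_0\supset U_1\supset U_2\supset\cdots\}$ of adapted sets containing $x$ with $\bigcap_\ell U_\ell=\{x\}$. Given $\mathcal U$, let $G_\ell=\{g\in G\mid gU_\ell\cap U_\ell\ne\emptyset\}$ (a finite index subgroup), $C_\ell=\bigcap_{g\in G}gG_\ell g^{-1}$, and let $\widehat G_\infty=\varprojlim G/C_\ell$ act coordinatewise on the odometer $X_\infty=\varprojlim G/G_\ell$, with base point $x_\infty=(eG_\ell)$. Let $\widehat G_\ell\subset\widehat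 G_\infty$ be the preimage of $G_\ell/C_\ell$ under the projection to $G/C_\ell$, let $\mathcal D_x=\varprojlim G_\ell/C_\ell\subset\widehat G_\infty$ be the discriminant, and let $\widehat U_\ell=\widehat G_\ell\cdot x_\infty\subset X_\infty$. Put $$K_\ell=\{\widehat g\in\widehat G_\ell\mid \widehat g\text{ acts as the identity on }\widehat U_\ell\},\qquad Z_\ell=\{\widehat h\in\mathcal D_x\mid \widehat h\,\widehat g\,\widehat h^{-1}=\widehat g\ \text{ for all }\widehat g\in\widehat G_\ell\}.$$ A *map of directed systems* from a chain of groups $\{S_\ell\}$ to a chain $\{S'_\ell\}$ (over $\mathbb N$, with inclusion maps) is an order-preserving map $\xi\colon\mathbb N\to\mathbb N$ together with homomorphisms $S_\ell\to S'_{\xi(\ell)}$ commuting with the inclusions; it induces a homomorphism $\varinjlim S_\ell\to\varinjlim S'_\ell$. An *isomorphism of direct limits* is a group isomorphism $\varinjlim S_\ell\to\varinjlim S'_\ell$ such that it and its inverse are both induced by maps of directed systems. **Theorem.** Let $(\mathfrak X,G,\Phi)$ be a Cantor action. 1. Every $x\in\mathfrak X$ has an adapted neighborhood basis. For every adapted neighborhood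 basis $\mathcal U$ at a point $x$, $K_0\subset K_1\subset\cdots$ and $Z_0\subset Z_1\subset\cdots$ are increasing chains of subgroups of $\mathcal D_x$. Let $\Upsilon_s=\varinjlim K_\ell$ (the stabilizer limit group) and $\Upsilon_c=\varinjlim Z_\ell$ (the centralizer limit group). 2. For every such $\mathcal U$, $Z_\ell\subset K_\ell$ for all $\ell$, and the induced homomorphism $\iota\colon\Upsilon_c\to\Upsilon_s$ is injective; that is, $\Upsilon_c(\Phi)\subset\Upsilon_s(\Phi)$. 3. The isomorphism classes, as direct limits, of $\Upsilon_s$ and $\Upsilon_c$, and of the inclusion $\iota$, depend neither on $x$ nor on $\mathcal U$, and are invariants of the conjugacy class of the action. Precisely, if $(\mathfrak X',G,\Psi)$ is a Cantor action conjugate to $(\mathfrak X,G,\Phi)$ (for instance $\Phi$ itself), and $\mathcal U$, $\mathcal U'$ are adapted neighborhood bases for $\Phi$ at $x\in\mathfrak X$ and for $\Psi$ at $x'\in\mathfrak X'$, with inclusions $\iota$, $\iota'$, then there are isomorphisms of direct limits $\theta_s\colon\Upsilon_s\to\Upsilon_s'$ and $\theta_c\colon\Upsilon_c\to\Upsilon_c'$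 with $\theta_s\circ\iota=\iota'\circ\theta_c$. -/

import Mathlib

open scoped Pointwise

/-! ### Cantor actions -/

/-- A Cantor space: a non-empty, compact, totally disconnected, perfect (metrizable) space.
The metric is a choice of metric compatible with the topology. -/
class IsCantorSpace (X : Type*) [MetricSpace X] : Prop extends
    CompactSpace X, TotallyDisconnectedSpace X, PerfectSpace X where
  nonempty : Nonempty X

/-- A Cantor action: a minimal equicontinuous action by homeomorphisms on a Cantor space. -/
class IsCantorAction (G : Type*) (X : Type*) [Group G] [MetricSpace X] [MulAction G X] : Prop
    extends IsCantorSpace X, ContinuousConstSMul G X, MulAction.IsMinimal G X where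
  equicontinuous : ∀ ε > (0 : ℝ), ∃ δ > (0 : ℝ), ∀ (x y : X) (g : G),
    dist x y < δ → dist (g • x) (g • y) < ε

section Adapted

variable (G : Type*) {X : Type*} [Group G] [MetricSpace X] [MulAction G X]

/-- `U` is adapted to the action: non-empty, clopen, and `g U ∩ U ≠ ∅` implies `g U = U`. -/
structure IsAdapted (U : Set X) : Prop where
  nonempty : U.Nonempty
  isClopen : IsClopen U
  smul_eq : ∀ g : G, (g • U ∩ U).Nonempty → g • U = U

/-- An adapted neighborhood basis at `x`: a properly descending sequence
`X = U_0 ⊃ U_1 ⊃ ⋯` of adapted sets containing `x`, with intersection `{x}`. -/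
structure AdaptedNhdBasis (x : X) where
  set : ℕ → Set X
  set_zero : set 0 = Set.univ
  mem : ∀ ℓ, x ∈ set ℓ
  ssubset : ∀ ℓ, set (ℓ + 1) ⊂ set ℓ
  iInter_eq : ⋂ ℓ, set ℓ = {x}
  adapted : ∀ ℓ, IsAdapted G (set ℓ)

variable {G}

/-- For an adapted set `U`, the set of return times to `U` is the stabilizer of `U`. -/
theorem IsAdapted.mem_stabilizer_iff {U : Set X} (hU : IsAdapted G U) (g : G) :
    g ∈ MulAction.stabilizer G U ↔ (g • U ∩ U).Nonempty := by
  rw [MulAction.mem_stabilizer_iff]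
  refine ⟨fun h => ?_, hU.smul_eq g⟩
  rw [h, Set.inter_self]
  exact hU.nonempty

theorem IsAdapted.finiteIndex [IsCantorAction G X] {U : Set X} (hU : IsAdapted G U) :
    (MulAction.stabilizer G U).FiniteIndex := by
  obtain ⟨t, ht⟩ :=
    (isCompact_univ (X := X)).exists_finite_cover_smul G hU.isClopen.isOpen hU.nonempty
  have hs : Function.Surjective
      (fun a : t => ((a : G) : G ⧸ MulAction.stabilizer G U)) := by
    intro q
    induction q using QuotientGroup.induction_on with
    | H g =>
      obtain ⟨x, hx⟩ := hU.nonempty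
      have hgx := ht (Set.mem_univ (g • x))
      simp only [Set.mem_iUnion] at hgx
      obtain ⟨a, ha, hax⟩ := hgx
      refine ⟨⟨a, ha⟩, ?_⟩
      apply QuotientGroup.eq.mpr
      rw [hU.mem_stabilizer_iff]
      refine ⟨a⁻¹ • g • x, ?_, Set.mem_smul_set_iff_inv_smul_mem.mp hax⟩
      rw [smul_smul]
      exact Set.smul_mem_smul_set hx
  have : Finite (G ⧸ MulAction.stabilizer G U) := Finite.of_surjective _ hs
  exact Subgroup.finiteIndex_of_finite_quotient

end Adapted

/-! ### Group chains and their odometers -/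

/-- A group chain `G = G_0 ⊇ G_1 ⊇ ⋯` of subgroups of finite index. -/
structure GroupChain (G : Type*) [Group G] where
  grp : ℕ → Subgroup G
  grp_zero : grp 0 = ⊤
  grp_succ_le : ∀ ℓ, grp (ℓ + 1) ≤ grp ℓ
  finiteIndex : ∀ ℓ, (grp ℓ).FiniteIndex

/-- The group chain `G_ℓ = {g | g U_ℓ ∩ U_ℓ ≠ ∅}` of an adapted neighborhood basis. -/
def AdaptedNhdBasis.groupChain {G X : Type*} [Group G] [MetricSpace X] [MulAction G X]
    [IsCantorAction G X] {x : X} (U : AdaptedNhdBasis G x) : GroupChain G where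
  grp ℓ := MulAction.stabilizer G (U.set ℓ)
  grp_zero := by
    rw [U.set_zero, eq_top_iff]
    intro g _
    rw [MulAction.mem_stabilizer_iff, Set.smul_set_univ]
  grp_succ_le ℓ g hg := by
    rw [(U.adapted ℓ).mem_stabilizer_iff]
    rw [(U.adapted (ℓ + 1)).mem_stabilizer_iff] at hg
    exact hg.mono (Set.inter_subset_inter
      (Set.smul_set_mono (U.ssubset ℓ).subset) (U.ssubset ℓ).subset)
  finiteIndex ℓ := (U.adapted ℓ).finiteIndex

namespace GroupChain

variable {G : Type*} [Group G] (Γ : GroupChain G)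

/-- The core `C_ℓ` of `G_ℓ`. -/
abbrev core (ℓ : ℕ) : Subgroup G := (Γ.grp ℓ).normalCore

/-- The finite group `Q_ℓ = G / C_ℓ`. -/
abbrev Q (ℓ : ℕ) : Type _ := G ⧸ Γ.core ℓ

/-- The finite `G`-space `X_ℓ = G / G_ℓ`. -/
abbrev X (ℓ : ℕ) : Type _ := G ⧸ Γ.grp ℓ

theorem core_succ_le (ℓ : ℕ) : Γ.core (ℓ + 1) ≤ Γ.core ℓ :=
  Subgroup.normalCore_mono (Γ.grp_succ_le ℓ)

/-- The quotient map `Q_{ℓ+1} → Q_ℓ`. -/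
def π (ℓ : ℕ) : Γ.Q (ℓ + 1) →* Γ.Q ℓ :=
  QuotientGroup.map _ _ (MonoidHom.id G) (Γ.core_succ_le ℓ)

/-- The quotient map `X_{ℓ+1} → X_ℓ`. -/
def p (ℓ : ℕ) : Γ.X (ℓ + 1) → Γ.X ℓ :=
  Subgroup.quotientMapOfLE (Γ.grp_succ_le ℓ)

/-- The odometer space `X_∞`, the inverse limit of the `X_ℓ`. -/
def XInf : Type _ := {ξ : ∀ ℓ, Γ.X ℓ // ∀ ℓ, Γ.p ℓ (ξ (ℓ + 1)) = ξ ℓ}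

/-- The base point `x_∞ = (e G_ℓ)_ℓ` of the odometer. -/
def basepoint : Γ.XInf := ⟨fun _ => ((1 : G) : _), fun _ => rfl⟩

/-- The group `Ĝ_∞`, the inverse limit of the `Q_ℓ`, as a subgroup of the product. -/
def limSubgroup : Subgroup (∀ ℓ, Γ.Q ℓ) where
  carrier := {q | ∀ ℓ, Γ.π ℓ (q (ℓ + 1)) = q ℓ}
  one_mem' ℓ := map_one _
  mul_mem' {a b} ha hb ℓ := by
    rw [Pi.mul_apply, Pi.mul_apply, map_mul, ha ℓ, hb ℓ]
  inv_mem' {a} ha ℓ := by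
    rw [Pi.inv_apply, Pi.inv_apply, map_inv, ha ℓ]

/-- The group `Ĝ_∞`. -/
abbrev GInf : Type _ := Γ.limSubgroup

/-- The projection `Ĝ_∞ → Q_ℓ`. -/
def proj (ℓ : ℕ) : Γ.GInf →* Γ.Q ℓ :=
  (Pi.evalMonoidHom (fun ℓ => Γ.Q ℓ) ℓ).comp Γ.limSubgroup.subtype

/-- The action of `Q_ℓ = G / C_ℓ` on `X_ℓ = G / G_ℓ` by left multiplication. -/
def permX (ℓ : ℕ) : Γ.Q ℓ →* Equiv.Perm (Γ.X ℓ) :=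
  QuotientGroup.lift _ (MulAction.toPermHom G (Γ.X ℓ)) (Subgroup.normalCore_eq_ker _).le

theorem permX_mk (ℓ : ℕ) (g a : G) :
    Γ.permX ℓ (g : Γ.Q ℓ) (a : Γ.X ℓ) = ((g * a : G) : Γ.X ℓ) := rfl

theorem p_permX (ℓ : ℕ) (q : Γ.Q (ℓ + 1)) (ξ : Γ.X (ℓ + 1)) :
    Γ.p ℓ (Γ.permX (ℓ + 1) q ξ) = Γ.permX ℓ (Γ.π ℓ q) (Γ.p ℓ ξ) := by
  induction q using QuotientGroup.induction_on
  induction ξ using QuotientGroup.induction_on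
  rfl

/-- The action of `Ĝ_∞` on the odometer `X_∞`, coordinatewise. -/
instance : MulAction Γ.GInf Γ.XInf where
  smul g ξ := ⟨fun ℓ => Γ.permX ℓ (Γ.proj ℓ g) (ξ.1 ℓ), fun ℓ => by
    rw [p_permX, ξ.2 ℓ]
    exact congrArg (fun q => Γ.permX ℓ q (ξ.1 ℓ)) (g.2 ℓ)⟩
  one_smul ξ := Subtype.ext <| funext fun ℓ => by
    change Γ.permX ℓ (Γ.proj ℓ 1) (ξ.1 ℓ) = ξ.1 ℓ
    rw [map_one, map_one, Equiv.Perm.one_apply]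
  mul_smul g h ξ := Subtype.ext <| funext fun ℓ => by
    change Γ.permX ℓ (Γ.proj ℓ (g * h)) (ξ.1 ℓ) =
      Γ.permX ℓ (Γ.proj ℓ g) (Γ.permX ℓ (Γ.proj ℓ h) (ξ.1 ℓ))
    rw [map_mul, map_mul, Equiv.Perm.mul_apply]

/-- The isotropy group `D_ℓ = G_ℓ / C_ℓ ⊆ Q_ℓ` of the base point of `X_ℓ`. -/
def D (ℓ : ℕ) : Subgroup (Γ.Q ℓ) := (Γ.grp ℓ).map (QuotientGroup.mk' (Γ.core ℓ))

/-- The clopen subgroup `Ĝ_ℓ ⊆ Ĝ_∞`, the preimage of `G_ℓ / C_ℓ`. -/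
def GHat (ℓ : ℕ) : Subgroup Γ.GInf := (Γ.D ℓ).comap (Γ.proj ℓ)

/-- The discriminant: the inverse limit of the groups `G_ℓ / C_ℓ`, as a subgroup of `Ĝ_∞`. -/
def discriminant : Subgroup Γ.GInf where
  carrier := {g | ∀ ℓ, Γ.proj ℓ g ∈ Γ.D ℓ}
  one_mem' ℓ := by rw [map_one]; exact one_mem _
  mul_mem' {a b} ha hb ℓ := by rw [map_mul]; exact mul_mem (ha ℓ) (hb ℓ)
  inv_mem' {a} ha ℓ := by rw [map_inv]; exact inv_mem (ha ℓ)

/-- The clopen set `Û_ℓ ⊆ X_∞` corresponding to `Ĝ_ℓ / 𝒟` under `X_∞ ≅ Ĝ_∞ / 𝒟`, that is, the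
orbit of the base point under `Ĝ_ℓ`. -/
def UHat (ℓ : ℕ) : Set Γ.XInf := {ξ | ∃ g ∈ Γ.GHat ℓ, ξ = g • Γ.basepoint}

theorem GHat_succ_le (ℓ : ℕ) : Γ.GHat (ℓ + 1) ≤ Γ.GHat ℓ := by
  rintro g ⟨a, ha, hag⟩
  refine ⟨a, Γ.grp_succ_le ℓ ha, ?_⟩
  have h : Γ.π ℓ (Γ.proj (ℓ + 1) g) = Γ.proj ℓ g := g.2 ℓ
  rw [← h, ← hag]
  rfl

theorem mem_D_iff (ℓ : ℕ) (q : Γ.Q ℓ) :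
    q ∈ Γ.D ℓ ↔ Γ.permX ℓ q ((1 : G) : Γ.X ℓ) = ((1 : G) : Γ.X ℓ) := by
  induction q using QuotientGroup.induction_on with
  | H g =>
    rw [permX_mk, mul_one, eq_comm, QuotientGroup.eq, inv_one, one_mul]
    constructor
    · rintro ⟨a, ha, hag⟩
      have h := Subgroup.normalCore_le _ (QuotientGroup.eq.mp hag)
      simpa using mul_mem ha h
    · exact fun hg => ⟨g, hg, rfl⟩

/-- The discriminant is the isotropy group of the base point of the odometer. -/
theorem mem_discriminant_iff (g : Γ.GInf) :
    g ∈ Γ.discriminant ↔ g • Γ.basepoint = Γ.basepoint :=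
  ⟨fun h => Subtype.ext <| funext fun ℓ => (Γ.mem_D_iff ℓ _).mp (h ℓ),
    fun h ℓ => (Γ.mem_D_iff ℓ _).mpr (congrFun (congrArg Subtype.val h) ℓ)⟩

/-- The stabilizer group chain: `K_ℓ` consists of the elements of `Ĝ_ℓ` which act as the
identity on `Û_ℓ`. -/
def stabilizerChain : ℕ →o Subgroup Γ.GInf where
  toFun ℓ := Γ.GHat ℓ ⊓ fixingSubgroup Γ.GInf (Γ.UHat ℓ)
  monotone' := monotone_nat_of_le_succ fun ℓ g hg => by
    have hfix := (mem_fixingSubgroup_iff _).mp hg.2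
    refine ⟨?_, (mem_fixingSubgroup_iff _).mpr ?_⟩
    · exact (Γ.mem_discriminant_iff g).mpr
        (hfix _ ⟨1, one_mem _, (one_smul _ _).symm⟩) (ℓ + 1)
    · rintro ξ ⟨h, hh, rfl⟩
      exact hfix _ ⟨h, Γ.GHat_succ_le ℓ hh, rfl⟩

/-- The centralizer group chain: `Z_ℓ` is the kernel of the adjoint action of the discriminant
on `Ĝ_ℓ`. -/
def centralizerChain : ℕ →o Subgroup Γ.GInf where
  toFun ℓ :=
    { carrier := {h | h ∈ Γ.discriminant ∧ ∀ g ∈ Γ.GHat ℓ, h * g * h⁻¹ = g}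
      one_mem' := ⟨one_mem _, fun g _ => by simp⟩
      mul_mem' := fun {a b} ha hb => ⟨mul_mem ha.1 hb.1, fun g hg => by
        have h : a * b * g * (a * b)⁻¹ = a * (b * g * b⁻¹) * a⁻¹ := by group
        rw [h, hb.2 g hg, ha.2 g hg]⟩
      inv_mem' := fun {a} ha => ⟨inv_mem ha.1, fun g hg => by
        have h := ha.2 g hg
        calc a⁻¹ * g * a⁻¹⁻¹ = a⁻¹ * (a * g * a⁻¹) * a⁻¹⁻¹ := by rw [h]
          _ = g := by group⟩ }
  monotone' := monotone_nat_of_le_succ fun ℓ _ hg =>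
    ⟨hg.1, fun k hk => hg.2 k (Γ.GHat_succ_le ℓ hk)⟩

/-- The inclusion of group chains `Z_ℓ ⊆ K_ℓ`. -/
theorem centralizerChain_le (ℓ : ℕ) : Γ.centralizerChain ℓ ≤ Γ.stabilizerChain ℓ := by
  intro g hg
  refine ⟨hg.1 ℓ, (mem_fixingSubgroup_iff _).mpr ?_⟩
  rintro ξ ⟨h, hh, rfl⟩
  have hc : g * h = h * g := mul_inv_eq_iff_eq_mul.mp (hg.2 h hh)
  rw [smul_smul, hc, mul_smul, (Γ.mem_discriminant_iff g).mp hg.1]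

end GroupChain

/-! ### Direct limits of increasing chains of subgroups -/

instance chainDirectedSystem {H : Type*} [Group H] (S : ℕ →o Subgroup H) :
    DirectedSystem (fun i => S i) (fun _ _ h => ⇑(Subgroup.inclusion (S.monotone h))) where
  map_self _ _ := rfl
  map_map _ _ _ _ _ _ := rfl

/-- The direct limit of the directed system of an increasing chain of subgroups, over `ℕ`,
with the inclusion maps. -/
abbrev ChainLimit {H : Type*} [Group H] (S : ℕ →o Subgroup H) : Type _ :=
  DirectLimit (fun i => S i) (fun _ _ h => Subgroup.inclusion (S.monotone h))

namespace ChainLimit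

variable {H H' : Type*} [Group H] [Group H']

/-- The class in the direct limit of an element of the `i`-th group. -/
def ofStage (S : ℕ →o Subgroup H) (i : ℕ) (a : S i) : ChainLimit S := ⟦⟨i, a⟩⟧

/-- A map between the directed systems given by two chains: an order-preserving map of the
indices, and compatible group homomorphisms. -/
structure SystemMap (S : ℕ →o Subgroup H) (S' : ℕ →o Subgroup H') where
  idx : ℕ →o ℕ
  hom : ∀ i, S i →* S' (idx i)
  comm : ∀ (i j : ℕ) (h : i ≤ j) (a : S i),
    hom j (Subgroup.inclusion (S.monotone h) a) =
      Subgroup.inclusion (S'.monotone (idx.monotone h)) (hom i a)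

/-- The homomorphism `θ` of direct limits is induced by the map `Ξ` of directed systems. -/
def SystemMap.Induces {S : ℕ →o Subgroup H} {S' : ℕ →o Subgroup H'} (Ξ : SystemMap S S')
    (θ : ChainLimit S →* ChainLimit S') : Prop :=
  ∀ (i : ℕ) (a : S i), θ (ofStage S i a) = ofStage S' (Ξ.idx i) (Ξ.hom i a)

/-- `θ` is an isomorphism of direct limits (and not only of the limit groups): `θ` and its
inverse are both induced by maps of the directed systems. -/
def IsDirectLimitIso {S : ℕ →o Subgroup H} {S' : ℕ →o Subgroup H'}
    (θ : ChainLimit S ≃* ChainLimit S') : Prop :=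
  (∃ Ξ : SystemMap S S', Ξ.Induces θ.toMonoidHom) ∧
    ∃ Ξ' : SystemMap S' S, Ξ'.Induces θ.symm.toMonoidHom

/-- The homomorphism of direct limits induced by an inclusion of chains `S_i ⊆ T_i`. -/
def inclusion {S T : ℕ →o Subgroup H} (h : ∀ i, S i ≤ T i) :
    ChainLimit S →* ChainLimit T where
  toFun := DirectLimit.map _ _ (fun i => Subgroup.inclusion (h i)) fun _ _ _ a =>
    Subtype.ext (rfl : (a : H) = a)
  map_one' := by
    rw [DirectLimit.one_def 0]
    exact (DirectLimit.one_def 0).symm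
  map_mul' := DirectLimit.induction₂ _ fun i x y => by
    rw [DirectLimit.mul_def]
    exact (DirectLimit.mul_def (G := fun i => T i)
      (f := fun _ _ h => Subgroup.inclusion (T.monotone h)) i
      (Subgroup.inclusion (h i) x) (Subgroup.inclusion (h i) y)).symm

theorem inclusion_ofStage {S T : ℕ →o Subgroup H} (h : ∀ i, S i ≤ T i) (i : ℕ) (a : S i) :
    inclusion h (ofStage S i a) = ofStage T i (Subgroup.inclusion (h i) a) := rfl

end ChainLimit

namespace GroupChain

variable {G : Type*} [Group G] (Γ : GroupChain G)

/-- The stabilizer limit group, the direct limit of the groups `K_ℓ`. -/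
abbrev UpsilonS : Type _ := ChainLimit Γ.stabilizerChain

/-- The centralizer limit group, the direct limit of the groups `Z_ℓ`. -/
abbrev UpsilonC : Type _ := ChainLimit Γ.centralizerChain

/-- The homomorphism from the centralizer limit group to the stabilizer limit group given by the
inclusions `Z_ℓ ⊆ K_ℓ`. -/
def upsilonInclusion : Γ.UpsilonC →* Γ.UpsilonS :=
  ChainLimit.inclusion Γ.centralizerChain_le

/-- The stabilizer limit groups of two group chains, and likewise their centralizer limit groups,
are isomorphic as direct limits, compatibly with the maps from the second to the first. -/
def LimitGroupsIso (Γ Γ' : GroupChain G) : Prop :=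
  ∃ (θs : Γ.UpsilonS ≃* Γ'.UpsilonS) (θc : Γ.UpsilonC ≃* Γ'.UpsilonC),
    ChainLimit.IsDirectLimitIso θs ∧ ChainLimit.IsDirectLimitIso θc ∧
      ∀ z, θs (Γ.upsilonInclusion z) = Γ'.upsilonInclusion (θc z)

end GroupChain

/-!
The limit groups do not depend on choices because the profinite group `Ĝ_∞`, defined through the
chain of an adapted neighborhood basis `U`, is intrinsic: it is the closure `closureGroup G X` of
the acting group in the group of permutations of `X` under uniform convergence. An element of the
closure permutes the finitely many translates of each `U_ℓ` as some group element does, which is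
determined modulo the core `C_ℓ`; this gives an isomorphism onto `Ĝ_∞`
(`AdaptedNhdBasis.equivGInf`). It is injective since equicontinuity makes the translates of `U_ℓ`
uniformly small, and surjective since limits of group elements along ultrafilters lie in the
closure (`exists_mem_closureGroup_tendsto`). The same limits show that the closure is transitive
on `X`.

Under this isomorphism the discriminant is the isotropy group of `x`, `K_ℓ` is the pointwise
stabilizer of `U_ℓ` (`AdaptedNhdBasis.equivGInf_mem_stabilizerChain_iff`), and `Z_ℓ` consists of the
elements that fix `x` and commute with every `e` in the closure such that `e x ∈ U_ℓ`
(`AdaptedNhdBasis.equivGInf_mem_centralizerChain_iff`). Both descriptions are monotone in the set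
`U_ℓ`. A conjugacy `h : X → X'`, followed by an element of the closure moving `h x` to `x'`, is a
homeomorphism that conjugates the two closures and matches the base points. By compactness the
image of one neighborhood basis and the other one are cofinal in each other, so conjugation makes
the chains cofinal in each other.

The direct limit of a chain of subgroups embeds in the ambient group as the union of the chain
(`ChainLimit.val`), so such a conjugation induces isomorphisms of direct limits, compatible with
inclusions of chains (`ChainLimit.exists_isDirectLimitIso`).

Adapted neighborhood bases exist because, for a clopen `W`, visiting `W` at the same times is an
invariant equivalence relation with open classes (`exists_isAdapted_subset`).
-/

/-! ### Direct limits of chains inside the ambient group -/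

namespace ChainLimit

variable {H H' : Type*} [Group H] [Group H']

/-- The embedding of the direct limit of a chain of subgroups in the ambient group; its range is
the union of the chain. -/
noncomputable def val (S : ℕ →o Subgroup H) : ChainLimit S →* H where
  toFun := DirectLimit.lift _ (fun _ a => (a : H)) fun _ _ _ _ => rfl
  map_one' := by
    rw [DirectLimit.one_def 0]
    rfl
  map_mul' := DirectLimit.induction₂ _ fun i x y => by
    rw [DirectLimit.mul_def]
    rfl

theorem val_ofStage (S : ℕ →o Subgroup H) (i : ℕ) (a : S i) : val S (ofStage S i a) = a := rfl

theorem val_injective (S : ℕ →o Subgroup H) : Function.Injective (val S) :=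
  DirectLimit.lift_injective _ _ (fun _ _ _ _ => rfl) fun _ => Subtype.val_injective

theorem exists_eq_ofStage {S : ℕ →o Subgroup H} (z : ChainLimit S) :
    ∃ i a, z = ofStage S i a := DirectLimit.exists_eq_mk _ z

theorem mem_range_val {S : ℕ →o Subgroup H} {a : H} : a ∈ (val S).range ↔ ∃ i, a ∈ S i := by
  constructor
  · rintro ⟨z, rfl⟩
    obtain ⟨i, a, rfl⟩ := exists_eq_ofStage z
    exact ⟨i, a.2⟩
  · rintro ⟨i, ha⟩
    exact ⟨ofStage S i ⟨a, ha⟩, rfl⟩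

theorem val_inclusion {S T : ℕ →o Subgroup H} (h : ∀ i, S i ≤ T i) (z : ChainLimit S) :
    val T (inclusion h z) = val S z := by
  obtain ⟨i, a, rfl⟩ := exists_eq_ofStage z
  rfl

theorem inclusion_injective {S T : ℕ →o Subgroup H} (h : ∀ i, S i ≤ T i) :
    Function.Injective (inclusion h) := fun z w hzw =>
  val_injective S <| by rw [← val_inclusion h, ← val_inclusion h, hzw]

/-- A homomorphism of ambient groups that carries each term of a chain into some term of another
chain restricts to a map of directed systems. -/
theorem exists_systemMap {S : ℕ →o Subgroup H} {S' : ℕ →o Subgroup H'} (φ : H →* H')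
    (hφ : ∀ i, ∃ j, ∀ a ∈ S i, φ a ∈ S' j) :
    ∃ Ξ : SystemMap S S', ∀ i (a : S i), (Ξ.hom i a : H') = φ a := by
  choose ξ hξ using hφ
  -- the index map has to be order-preserving, so it is replaced by its running maximum
  refine ⟨⟨partialSups ξ, fun i => (φ.comp (S i).subtype).codRestrict _ fun a => ?_,
    fun i j h a => rfl⟩, fun i a => rfl⟩
  exact S'.monotone (le_partialSups ξ i) (hξ i a a.2)

theorem SystemMap.induces_of_val {S : ℕ →o Subgroup H} {S' : ℕ →o Subgroup H'} {φ : H →* H'}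
    {Ξ : SystemMap S S'} (hΞ : ∀ i (a : S i), (Ξ.hom i a : H') = φ a)
    {θ : ChainLimit S →* ChainLimit S'} (hθ : ∀ z, val S' (θ z) = φ (val S z)) :
    Ξ.Induces θ := fun i a => val_injective S' <| by
  rw [hθ, val_ofStage, val_ofStage, hΞ]

/-- An isomorphism of ambient groups under which two chains are cofinal in one another induces an
isomorphism of their direct limits. -/
theorem exists_isDirectLimitIso {S : ℕ →o Subgroup H} {S' : ℕ →o Subgroup H'} (φ : H ≃* H')
    (hφ : ∀ i, ∃ j, ∀ a ∈ S i, φ a ∈ S' j) (hφ' : ∀ i, ∃ j, ∀ a ∈ S' i, φ.symm a ∈ S j) :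
    ∃ θ : ChainLimit S ≃* ChainLimit S', IsDirectLimitIso θ ∧
      ∀ z, val S' (θ z) = φ (val S z) := by
  have hrange : (val S).range.map φ.toMonoidHom = (val S').range := by
    ext b
    rw [Subgroup.mem_map_equiv, mem_range_val, mem_range_val]
    constructor
    · rintro ⟨i, hi⟩
      obtain ⟨j, hj⟩ := hφ i
      exact ⟨j, by simpa using hj _ hi⟩
    · rintro ⟨i, hi⟩
      obtain ⟨j, hj⟩ := hφ' i
      exact ⟨j, hj _ hi⟩
  let θ : ChainLimit S ≃* ChainLimit S' :=
    (MonoidHom.ofInjective (val_injective S)).trans <| (φ.subgroupMap _).trans <|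
      (MulEquiv.subgroupCongr hrange).trans (MonoidHom.ofInjective (val_injective S')).symm
  have hθ : ∀ z, val S' (θ z) = φ (val S z) := fun z =>
    MonoidHom.apply_ofInjective_symm (val_injective S') _
  have hθ' : ∀ z, val S (θ.symm z) = φ.symm (val S' z) := fun z => by
    rw [MulEquiv.eq_symm_apply, ← hθ, MulEquiv.apply_symm_apply]
  obtain ⟨Ξ, hΞ⟩ := exists_systemMap φ.toMonoidHom hφ
  obtain ⟨Ξ', hΞ'⟩ := exists_systemMap φ.symm.toMonoidHom hφ'
  exact ⟨θ, ⟨⟨Ξ, Ξ.induces_of_val hΞ hθ⟩, ⟨Ξ', Ξ'.induces_of_val hΞ' hθ'⟩⟩, hθ⟩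

end ChainLimit

namespace GroupChain

theorem limitGroupsIso_of_mulEquiv {G : Type*} [Group G] {Γ Γ' : GroupChain G}
    (φ : Γ.GInf ≃* Γ'.GInf)
    (hs : ∀ i, ∃ j, ∀ a ∈ Γ.stabilizerChain i, φ a ∈ Γ'.stabilizerChain j)
    (hs' : ∀ i, ∃ j, ∀ a ∈ Γ'.stabilizerChain i, φ.symm a ∈ Γ.stabilizerChain j)
    (hc : ∀ i, ∃ j, ∀ a ∈ Γ.centralizerChain i, φ a ∈ Γ'.centralizerChain j)
    (hc' : ∀ i, ∃ j, ∀ a ∈ Γ'.centralizerChain i, φ.symm a ∈ Γ.centralizerChain j) :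
    Γ.LimitGroupsIso Γ' := by
  obtain ⟨θs, hθs, hs⟩ := ChainLimit.exists_isDirectLimitIso φ hs hs'
  obtain ⟨θc, hθc, hc⟩ := ChainLimit.exists_isDirectLimitIso φ hc hc'
  refine ⟨θs, θc, hθs, hθc, fun z => ChainLimit.val_injective _ ?_⟩
  rw [hs, upsilonInclusion, ChainLimit.val_inclusion, upsilonInclusion, ChainLimit.val_inclusion,
    hc]

theorem stabilizerChain_le_discriminant {G : Type*} [Group G] (Γ : GroupChain G) (ℓ : ℕ) :
    Γ.stabilizerChain ℓ ≤ Γ.discriminant := fun g hg =>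
  (Γ.mem_discriminant_iff g).mpr <|
    (mem_fixingSubgroup_iff _).mp hg.2 _ ⟨1, one_mem _, (one_smul _ _).symm⟩

end GroupChain

/-! ### Existence of adapted neighborhood bases -/

section Existence

variable (G : Type*) {X : Type*} [Group G] [MetricSpace X] [MulAction G X] [IsCantorAction G X]

/-- For a clopen set `W`, the points `z` that visit `W` at exactly the same times as `x` form an
adapted set: these sets are the classes of an invariant equivalence relation, and equicontinuity
makes the classes open. -/
theorem exists_isAdapted_subset {W : Set X} (hW : IsClopen W) {x : X} (hx : x ∈ W) :
    ∃ U : Set X, IsAdapted G U ∧ x ∈ U ∧ U ⊆ W := by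
  obtain ⟨η, hη, hWη⟩ : ∃ η > (0 : ℝ), ∀ z w, dist z w < η → z ∈ W → w ∈ W := by
    obtain ⟨η, hη, h⟩ := lebesgue_number_lemma_of_metric (s := Set.univ)
      (c := fun b : Bool => bif b then W else Wᶜ) isCompact_univ
      (by rintro (_ | _); exacts [hW.compl.isOpen, hW.isOpen])
      (fun z _ => by
        by_cases hz : z ∈ W
        exacts [Set.mem_iUnion.mpr ⟨true, hz⟩, Set.mem_iUnion.mpr ⟨false, hz⟩])
    refine ⟨η, hη, fun z w hzw hz => ?_⟩
    obtain ⟨(_ | _), hb⟩ := h z trivial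
    · exact absurd hz (hb (Metric.mem_ball_self hη))
    · exact hb (Metric.mem_ball'.mpr hzw)
  obtain ⟨δ, hδ, hδη⟩ := IsCantorAction.equicontinuous (G := G) (X := X) η hη
  have hstep : ∀ z w, dist z w < δ → ∀ g : G, g • z ∈ W ↔ g • w ∈ W := fun z w h g =>
    ⟨hWη _ _ (hδη z w g h), hWη _ _ (hδη w z g (by rwa [dist_comm]))⟩
  let U : Set X := {z | ∀ g : G, g • z ∈ W ↔ g • x ∈ W}
  have hopen : IsOpen U := Metric.isOpen_iff.mpr fun z hz =>
    ⟨δ, hδ, fun w hw g => (hstep w z hw g).trans (hz g)⟩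
  have hclosed : IsClosed U := isOpen_compl_iff.mp <| Metric.isOpen_iff.mpr fun z hz =>
    ⟨δ, hδ, fun w hw hwU => hz fun g => ((hstep w z hw g).symm).trans (hwU g)⟩
  refine ⟨U, ⟨⟨x, fun _ => Iff.rfl⟩, ⟨hclosed, hopen⟩, ?_⟩, fun _ => Iff.rfl, fun z hz => ?_⟩
  · rintro g ⟨y, hy, hyU⟩
    rw [Set.mem_smul_set_iff_inv_smul_mem] at hy
    ext z
    rw [Set.mem_smul_set_iff_inv_smul_mem]
    have key : ∀ k : G, k • g⁻¹ • x ∈ W ↔ k • x ∈ W := fun k => by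
      rw [smul_smul, ← hyU, mul_smul]
      exact hy k
    constructor
    · intro hz k
      have := hz (k * g)
      rw [mul_smul, smul_inv_smul] at this
      rw [this, ← key, mul_smul, smul_inv_smul]
    · intro hz k
      rw [← key]
      simpa only [mul_smul] using hz (k * g⁻¹)
  · have := hz 1
    rw [one_smul, one_smul] at this
    exact this.mpr hx

theorem exists_isAdapted_subset_of_mem_nhds {x : X} {N : Set X} (hN : N ∈ nhds x) :
    ∃ U : Set X, IsAdapted G U ∧ x ∈ U ∧ U ⊆ N := by
  have : IsCantorSpace X := IsCantorAction.toIsCantorSpace G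
  obtain ⟨O, hON, hO, hxO⟩ := mem_nhds_iff.mp hN
  obtain ⟨W, hW, hxW, hWO⟩ := compact_exists_isClopen_in_isOpen hO hxO
  obtain ⟨U, hU, hxU, hUW⟩ := exists_isAdapted_subset G hW hxW
  exact ⟨U, hU, hxU, hUW.trans (hWO.trans hON)⟩

theorem exists_isAdapted_ssubset {x : X} {U : Set X} (hU : IsAdapted G U) (hx : x ∈ U)
    {ε : ℝ} (hε : 0 < ε) :
    ∃ V : Set X, IsAdapted G V ∧ x ∈ V ∧ V ⊂ U ∧ V ⊆ Metric.ball x ε := by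
  have : IsCantorSpace X := IsCantorAction.toIsCantorSpace G
  -- since `X` is perfect, `U` contains a second point, to be removed
  obtain ⟨y, ⟨hyU, -⟩, hyx⟩ := accPt_iff_nhds.mp (PerfectSpace.univ_preperfect x trivial) U
    (hU.isClopen.isOpen.mem_nhds hx)
  obtain ⟨V, hV, hxV, hVN⟩ := exists_isAdapted_subset_of_mem_nhds G
    (Filter.inter_mem (Filter.inter_mem (hU.isClopen.isOpen.mem_nhds hx)
      (isOpen_compl_singleton.mem_nhds (Ne.symm hyx))) (Metric.ball_mem_nhds x hε))
  exact ⟨V, hV, hxV, ⟨fun z hz => (hVN hz).1.1, fun h => (hVN (h hyU)).1.2 rfl⟩,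
    fun z hz => (hVN hz).2⟩

theorem nonempty_adaptedNhdBasis (x : X) : Nonempty (AdaptedNhdBasis G x) := by
  let A := {U : Set X // IsAdapted G U ∧ x ∈ U}
  have hnext : ∀ (n : ℕ) (U : A), ∃ V : A, V.1 ⊂ U.1 ∧ V.1 ⊆ Metric.ball x (1 / (n + 1)) :=
    fun n U =>
      let ⟨V, hV, hxV, hVU⟩ := exists_isAdapted_ssubset G U.2.1 U.2.2 Nat.one_div_pos_of_nat
      ⟨⟨V, hV, hxV⟩, hVU⟩
  choose next hss hball using hnext
  let u : ℕ → A := fun n => Nat.rec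
    ⟨Set.univ, ⟨⟨x, trivial⟩, isClopen_univ, fun g _ => Set.smul_set_univ⟩, trivial⟩ next n
  refine ⟨⟨fun n => (u n).1, rfl, fun n => (u n).2.2, fun n => hss n (u n), ?_,
    fun n => (u n).2.1⟩⟩
  refine Set.eq_singleton_iff_unique_mem.mpr ⟨Set.mem_iInter.mpr fun n => (u n).2.2, ?_⟩
  intro z hz
  refine eq_of_forall_dist_le fun ε hε => ?_
  obtain ⟨n, hn⟩ := exists_nat_one_div_lt hε
  exact ((Metric.mem_ball.mp (hball n (u n) (Set.mem_iInter.mp hz (n + 1)))).trans hn).le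

end Existence
/-! ### The uniform closure of the acting group -/

section ClosureGroup

open Filter Topology

variable (G : Type*) (X : Type*) [Group G] [MetricSpace X] [MulAction G X] [IsCantorAction G X]

/-- The closure of the acting group in the group of permutations of `X`, with respect to uniform
convergence. It depends on the action only, not on a base point or a neighborhood basis. -/
def closureGroup : Subgroup (Equiv.Perm X) where
  carrier := {f | ∀ ε > (0 : ℝ), ∃ g : G, ∀ z, dist (f z) (g • z) < ε}
  one_mem' ε hε := ⟨1, fun z => by simpa using hε⟩
  mul_mem' {a b} ha hb ε hε := by
    obtain ⟨g, hg⟩ := ha (ε / 2) (half_pos hε)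
    obtain ⟨δ, hδ, hδε⟩ := IsCantorAction.equicontinuous (G := G) (X := X) (ε / 2) (half_pos hε)
    obtain ⟨k, hk⟩ := hb δ hδ
    refine ⟨g * k, fun z => ?_⟩
    rw [mul_smul, Equiv.Perm.mul_apply]
    linarith [dist_triangle (a (b z)) (g • b z) (g • k • z), hg (b z), hδε _ _ g (hk z)]
  inv_mem' {a} ha ε hε := by
    obtain ⟨δ, hδ, hδε⟩ := IsCantorAction.equicontinuous (G := G) (X := X) ε hε
    obtain ⟨g, hg⟩ := ha δ hδ
    refine ⟨g⁻¹, fun z => ?_⟩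
    have h := hg (a⁻¹ z)
    have hz : a (a⁻¹ z) = z := a.apply_symm_apply z
    rw [hz, dist_comm] at h
    simpa using hδε _ _ g⁻¹ h

variable {G X}

theorem continuous_of_mem_closureGroup {f : Equiv.Perm X} (hf : f ∈ closureGroup G X) :
    Continuous f := by
  refine Metric.continuous_iff.mpr fun z ε hε => ?_
  obtain ⟨δ, hδ, hδε⟩ :=
    IsCantorAction.equicontinuous (G := G) (X := X) (ε / 3) (by positivity)
  obtain ⟨g, hg⟩ := hf (ε / 3) (by positivity)
  refine ⟨δ, hδ, fun w hw => ?_⟩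
  have hz := hg z
  rw [dist_comm] at hz
  linarith [dist_triangle4 (f w) (g • w) (g • z) (f z), hg w, hδε _ _ g hw]

theorem eq_of_tendsto_smul_of_inv {ι : Type*} {l : Filter ι} [l.NeBot] {g k : ι → G}
    (hkg : ∀ i, k i * g i = 1) {z w v : X} (hw : Tendsto (fun i => g i • z) l (𝓝 w))
    (hv : Tendsto (fun i => k i • w) l (𝓝 v)) : v = z := by
  refine eq_of_forall_dist_le fun ε hε => ?_
  obtain ⟨δ, hδ, hδε⟩ := IsCantorAction.equicontinuous (G := G) (X := X) (ε / 2) (half_pos hε)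
  obtain ⟨i, hi, hi'⟩ := ((Metric.tendsto_nhds.mp hw δ hδ).and
    (Metric.tendsto_nhds.mp hv (ε / 2) (half_pos hε))).exists
  have h := hδε _ _ (k i) hi
  rw [smul_smul, hkg, one_smul, dist_comm] at h
  rw [dist_comm] at hi'
  linarith [dist_triangle v (k i • w) z]

/-- By equicontinuity and compactness, every ultrafilter of group elements converges to an element
of the closure. This is the only form in which compactness of the closure is needed. -/
theorem exists_mem_closureGroup_tendsto {ι : Type*} (𝒰 : Ultrafilter ι) (g : ι → G) :
    ∃ f ∈ closureGroup G X, ∀ z, Tendsto (fun i => g i • z) 𝒰 (𝓝 (f z)) := by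
  have : IsCantorSpace X := IsCantorAction.toIsCantorSpace G
  have hlim : ∀ g : ι → G, ∃ f : X → X, ∀ z, Tendsto (fun i => g i • z) 𝒰 (𝓝 (f z)) :=
    fun g => ⟨fun z => (𝒰.map fun i => g i • z).lim, fun z =>
      (𝒰.map fun i => g i • z).le_nhds_lim⟩
  obtain ⟨f, hf⟩ := hlim g
  obtain ⟨f', hf'⟩ := hlim fun i => (g i)⁻¹
  refine ⟨⟨f, f', fun z => eq_of_tendsto_smul_of_inv (fun i => inv_mul_cancel (g i))
    (hf z) (hf' _), fun z => eq_of_tendsto_smul_of_inv (fun i => mul_inv_cancel (g i))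
    (hf' z) (hf _)⟩, fun ε hε => ?_, hf⟩
  obtain ⟨δ, hδ, hδε⟩ :=
    IsCantorAction.equicontinuous (G := G) (X := X) (ε / 3) (by positivity)
  -- `f` inherits the common modulus of continuity of the group elements
  have hfε : ∀ z w, dist z w < δ → dist (f z) (f w) ≤ ε / 3 := fun z w h =>
    le_of_tendsto ((hf z).dist (hf w)) (Eventually.of_forall fun i => (hδε z w (g i) h).le)
  obtain ⟨t, -, htf, ht⟩ := (isCompact_univ (X := X)).finite_cover_balls hδ
  obtain ⟨i, hi⟩ := ((htf.eventually_all).mpr fun z _ =>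
    Metric.tendsto_nhds.mp (hf z) (ε / 3) (by positivity)).exists
  refine ⟨g i, fun z => ?_⟩
  obtain ⟨w, hw, hzw⟩ := Set.mem_iUnion₂.mp (ht (Set.mem_univ z))
  have h1 := hfε z w hzw
  have h2 := hi w hw
  have h3 := hδε w z (g i) (by rwa [dist_comm])
  rw [dist_comm] at h2
  change dist (f z) (g i • z) < ε
  linarith [dist_triangle4 (f z) (f w) (g i • w) (g i • z)]

/-- The closure of a minimal group acts transitively. -/
theorem exists_mem_closureGroup_apply_eq (x y : X) : ∃ f ∈ closureGroup G X, f x = y := by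
  have hne : (comap (fun g : G => g • x) (𝓝 y)).NeBot :=
    comap_neBot fun t ht => by
      obtain ⟨-, ht', g, rfl⟩ := mem_closure_iff_nhds.mp (MulAction.dense_orbit G x y) t ht
      exact ⟨g, ht'⟩
  obtain ⟨f, hf, hlim⟩ :=
    exists_mem_closureGroup_tendsto (X := X) (Ultrafilter.of (comap (fun g : G => g • x) (𝓝 y))) id
  exact ⟨f, hf, tendsto_nhds_unique (hlim x) (tendsto_comap.mono_left (Ultrafilter.of_le _))⟩

/-- A conjugacy of actions carries the closure of the group into the closure of the group. -/
theorem permCongr_mem_closureGroup {X' : Type*} [MetricSpace X'] [MulAction G X']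
    [IsCantorAction G X'] (h : X ≃ₜ X') (hG : ∀ (g : G) (z : X), h (g • z) = g • h z)
    {f : Equiv.Perm X} (hf : f ∈ closureGroup G X) :
    h.toEquiv.permCongr f ∈ closureGroup G X' := by
  have : IsCantorSpace X := IsCantorAction.toIsCantorSpace G
  intro ε hε
  obtain ⟨δ, hδ, hδε⟩ := Metric.uniformContinuous_iff.mp
    (CompactSpace.uniformContinuous_of_continuous h.continuous) ε hε
  obtain ⟨g, hg⟩ := hf δ hδ
  refine ⟨g, fun z => ?_⟩
  have := hδε (hg (h.symm z))
  rwa [hG, h.apply_symm_apply] at this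

end ClosureGroup

/-! ### Translates of the sets of a neighborhood basis -/

theorem IsAdapted.smul_eq_smul {G X : Type*} [Group G] [MetricSpace X] [MulAction G X]
    {U : Set X} (hU : IsAdapted G U) {z : X} {k k' : G}
    (hk : z ∈ k • U) (hk' : z ∈ k' • U) : k • U = k' • U := by
  rw [Set.mem_smul_set_iff_inv_smul_mem] at hk hk'
  have h : (k'⁻¹ * k) • U = U := hU.smul_eq _
    ⟨k'⁻¹ • z, by rw [mul_smul, Set.smul_mem_smul_set_iff, Set.mem_smul_set_iff_inv_smul_mem]
                  exact hk, hk'⟩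
  rw [mul_smul, inv_smul_eq_iff] at h
  exact h

namespace AdaptedNhdBasis

open Filter Topology

variable {G X : Type*} [Group G] [MetricSpace X] [MulAction G X] {x : X}
  (U : AdaptedNhdBasis G x)

theorem set_antitone : Antitone U.set := antitone_nat_of_succ_le fun ℓ => (U.ssubset ℓ).subset

/-- The map `f` permutes the translates of `U_ℓ` in the same way as the group element `g`. -/
def AgreesAt (ℓ : ℕ) (f : X → X) (g : G) : Prop :=
  ∀ (k : G) (z : X), z ∈ k • U.set ℓ → f z ∈ (g * k) • U.set ℓ

variable {U} in
theorem AgreesAt.mul {ℓ : ℕ} {f f' : X → X} {g g' : G} (h : U.AgreesAt ℓ f g)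
    (h' : U.AgreesAt ℓ f' g') : U.AgreesAt ℓ (f ∘ f') (g * g') := fun k z hz => by
  rw [mul_assoc]
  exact h _ _ (h' k z hz)

variable [IsCantorAction G X]

theorem exists_set_subset {N : Set X} (hN : N ∈ 𝓝 x) : ∃ ℓ, U.set ℓ ⊆ N := by
  have : IsCantorSpace X := IsCantorAction.toIsCantorSpace G
  refine exists_subset_nhds_of_isCompact' U.set_antitone.directed_ge
    (fun ℓ => (U.adapted ℓ).isClopen.isClosed.isCompact) (fun ℓ => (U.adapted ℓ).isClopen.isClosed)
    fun y hy => ?_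
  rw [U.iInter_eq] at hy
  rwa [Set.mem_singleton_iff.mp hy]

theorem exists_mem_smul (ℓ : ℕ) (z : X) : ∃ k : G, z ∈ k • U.set ℓ := by
  obtain ⟨g, hg⟩ := (U.adapted ℓ).isClopen.isOpen.exists_smul_mem G z (U.adapted ℓ).nonempty
  exact ⟨g⁻¹, by rwa [Set.mem_smul_set_iff_inv_smul_mem, inv_inv]⟩

/-- By equicontinuity the translates of `U_ℓ` are uniformly small, so that they separate points. -/
theorem eq_of_forall_mem_smul {z w : X}
    (h : ∀ (ℓ : ℕ) (k : G), z ∈ k • U.set ℓ → w ∈ k • U.set ℓ) : w = z := by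
  refine eq_of_forall_dist_le fun ε hε => ?_
  obtain ⟨δ, hδ, hδε⟩ := IsCantorAction.equicontinuous (G := G) (X := X) (ε / 2) (half_pos hε)
  obtain ⟨ℓ, hℓ⟩ := U.exists_set_subset (Metric.ball_mem_nhds x hδ)
  obtain ⟨k, hk⟩ := U.exists_mem_smul ℓ z
  have hw := h ℓ k hk
  rw [Set.mem_smul_set_iff_inv_smul_mem] at hk hw
  have h1 := hδε _ _ k (hℓ hk)
  have h2 := hδε _ _ k (hℓ hw)
  rw [smul_inv_smul] at h1 h2
  linarith [dist_triangle_right w z (k • x)]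

theorem exists_pos_forall_mem_smul (ℓ : ℕ) : ∃ δ > (0 : ℝ), ∀ (k : G) (z w : X),
    dist z w < δ → z ∈ k • U.set ℓ → w ∈ k • U.set ℓ := by
  have : IsCantorSpace X := IsCantorAction.toIsCantorSpace G
  obtain ⟨δ, hδ, h⟩ := lebesgue_number_lemma_of_metric (c := fun k : G => k • U.set ℓ)
    (isCompact_univ (X := X)) (fun k => (U.adapted ℓ).isClopen.isOpen.smul k)
    fun z _ => Set.mem_iUnion.mpr (U.exists_mem_smul ℓ z)
  refine ⟨δ, hδ, fun k z w hzw hz => ?_⟩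
  obtain ⟨k', hk'⟩ := h z trivial
  rw [(U.adapted ℓ).smul_eq_smul hz (hk' (Metric.mem_ball_self hδ))]
  exact hk' (Metric.mem_ball'.mpr hzw)

/-! ### The closure of the group as an inverse limit of finite quotients -/

variable {U}

theorem AgreesAt.of_succ {ℓ : ℕ} {f : X → X} {g : G} (h : U.AgreesAt (ℓ + 1) f g) :
    U.AgreesAt ℓ f g := by
  intro k z hz
  obtain ⟨k', hk'⟩ := U.exists_mem_smul (ℓ + 1) z
  have hsub := (U.ssubset ℓ).subset
  have := Set.smul_set_mono hsub (h k' z hk')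
  rwa [mul_smul, (U.adapted ℓ).smul_eq_smul (Set.smul_set_mono hsub hk') hz, ← mul_smul] at this

/-- The core `C_ℓ` is the kernel of the action on the set of translates of `U_ℓ`. -/
theorem mk_eq_mk_iff {ℓ : ℕ} {g g' : G} :
    (g : U.groupChain.Q ℓ) = (g' : U.groupChain.Q ℓ) ↔
      ∀ k : G, (g * k) • U.set ℓ = (g' * k) • U.set ℓ := by
  have hmem : (g : U.groupChain.Q ℓ) = (g' : U.groupChain.Q ℓ) ↔
      ∀ k : G, k * (g⁻¹ * g') * k⁻¹ ∈ MulAction.stabilizer G (U.set ℓ) := QuotientGroup.eq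
  rw [hmem]
  constructor
  · intro h k
    have := h k⁻¹
    rw [MulAction.mem_stabilizer_iff, inv_inv] at this
    rw [← this, ← mul_smul, this]
    congr 1
    group
  · intro h k
    rw [MulAction.mem_stabilizer_iff, mul_assoc, mul_assoc, mul_smul, mul_smul, ← h, ← mul_smul,
      ← mul_smul]
    simp

theorem AgreesAt.iff_mk_eq {ℓ : ℕ} {f : X → X} {g g' : G} (h : U.AgreesAt ℓ f g) :
    U.AgreesAt ℓ f g' ↔ (g : U.groupChain.Q ℓ) = (g' : U.groupChain.Q ℓ) := by
  rw [mk_eq_mk_iff]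
  constructor
  · intro h' k
    obtain ⟨z, hz⟩ := (U.adapted ℓ).nonempty
    have hkz := Set.smul_mem_smul_set (a := k) hz
    exact (U.adapted ℓ).smul_eq_smul (h k _ hkz) (h' k _ hkz)
  · intro h' k z hz
    rw [← h' k]
    exact h k z hz

variable (U)

theorem exists_agreesAt (ℓ : ℕ) (f : closureGroup G X) : ∃ g : G, U.AgreesAt ℓ f.1 g := by
  obtain ⟨δ, hδ, h⟩ := U.exists_pos_forall_mem_smul ℓ
  obtain ⟨g, hg⟩ := f.2 δ hδ
  refine ⟨g, fun k z hz => h _ (g • z) _ (by rw [dist_comm]; exact hg z) ?_⟩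
  rw [mul_smul]
  exact Set.smul_mem_smul_set hz

/-- The homomorphism from the closure of the group to the inverse limit `Ĝ_∞`, which records how
an element permutes the translates of each `U_ℓ`. -/
noncomputable def toGInf : closureGroup G X →* U.groupChain.GInf where
  toFun f := ⟨fun ℓ => ((U.exists_agreesAt ℓ f).choose : G), fun ℓ =>
    ((U.exists_agreesAt (ℓ + 1) f).choose_spec.of_succ.iff_mk_eq).mp
      (U.exists_agreesAt ℓ f).choose_spec⟩
  map_one' := Subtype.ext <| funext fun ℓ =>
    ((U.exists_agreesAt ℓ 1).choose_spec.iff_mk_eq (g' := 1)).mp fun k z hz => by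
      rw [one_mul]
      exact hz
  map_mul' f f' := Subtype.ext <| funext fun ℓ =>
    ((U.exists_agreesAt ℓ (f * f')).choose_spec.iff_mk_eq).mp
      ((U.exists_agreesAt ℓ f).choose_spec.mul (U.exists_agreesAt ℓ f').choose_spec)

theorem proj_toGInf_eq_iff {ℓ : ℕ} {f : closureGroup G X} {g : G} :
    U.groupChain.proj ℓ (U.toGInf f) = (g : U.groupChain.Q ℓ) ↔ U.AgreesAt ℓ f.1 g :=
  ((U.exists_agreesAt ℓ f).choose_spec.iff_mk_eq).symm

theorem toGInf_injective : Function.Injective U.toGInf := by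
  refine (injective_iff_map_eq_one _).mpr fun f hf => Subtype.ext <| Equiv.ext fun z =>
    U.eq_of_forall_mem_smul fun ℓ k hz => ?_
  have h : U.AgreesAt ℓ f.1 1 := U.proj_toGInf_eq_iff.mp <| by
    rw [hf, map_one]
    rfl
  simpa using h k z hz

theorem toGInf_surjective : Function.Surjective U.toGInf := by
  intro q
  have hq : ∀ ℓ, ∃ g : G, (g : U.groupChain.Q ℓ) = q.1 ℓ := fun ℓ => QuotientGroup.mk_surjective _
  choose g hg using hq
  obtain ⟨f, hf, hlim⟩ := exists_mem_closureGroup_tendsto (X := X) (hyperfilter ℕ) g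
  have hmk : ∀ ℓ n, ℓ ≤ n → ((g n : G) : U.groupChain.Q ℓ) = q.1 ℓ := by
    intro ℓ n h
    suffices ∀ g : G, (g : U.groupChain.Q n) = q.1 n → (g : U.groupChain.Q ℓ) = q.1 ℓ from
      this _ (hg n)
    induction n, h using Nat.le_induction with
    | base => exact fun _ h => h
    | succ n _ ih =>
      intro g hg
      refine ih g ?_
      rw [← q.2 n, ← hg]
      rfl
  refine ⟨⟨f, hf⟩, Subtype.ext <| funext fun ℓ => ?_⟩
  refine (U.proj_toGInf_eq_iff.mpr ?_).trans (hg ℓ)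
  intro k z hz
  refine ((U.adapted ℓ).isClopen.isClosed.smul (g ℓ * k)).mem_of_tendsto (hlim z) ?_
  filter_upwards [Nat.hyperfilter_le_atTop (eventually_ge_atTop ℓ)] with n hn
  rw [mk_eq_mk_iff.mp ((hg ℓ).trans (hmk ℓ n hn).symm) k, mul_smul]
  exact Set.smul_mem_smul_set hz

/-- The closure of the group is the inverse limit `Ĝ_∞` of the finite quotients defined by any
adapted neighborhood basis. -/
noncomputable def equivGInf : closureGroup G X ≃* U.groupChain.GInf :=
  MulEquiv.ofBijective U.toGInf ⟨U.toGInf_injective, U.toGInf_surjective⟩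

/-! ### The two chains in terms of the closure of the group -/

theorem equivGInf_mem_GHat_iff {ℓ : ℕ} {f : closureGroup G X} :
    U.equivGInf f ∈ U.groupChain.GHat ℓ ↔ f.1 x ∈ U.set ℓ := by
  obtain ⟨g, hg⟩ := U.exists_agreesAt ℓ f
  have hfx : f.1 x ∈ g • U.set ℓ := by
    simpa using hg 1 x (by simpa using U.mem ℓ)
  have hmem : U.equivGInf f ∈ U.groupChain.GHat ℓ ↔ g ∈ MulAction.stabilizer G (U.set ℓ) := by
    change U.groupChain.proj ℓ (U.toGInf f) ∈ U.groupChain.D ℓ ↔ _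
    rw [GroupChain.mem_D_iff, U.proj_toGInf_eq_iff.mpr hg, GroupChain.permX_mk, mul_one, eq_comm,
      QuotientGroup.eq, inv_one, one_mul]
    rfl
  rw [hmem, MulAction.mem_stabilizer_iff]
  refine ⟨fun h => h ▸ hfx, fun h => ?_⟩
  exact (U.adapted ℓ).smul_eq g ⟨_, hfx, h⟩

theorem equivGInf_mem_discriminant_iff {f : closureGroup G X} :
    U.equivGInf f ∈ U.groupChain.discriminant ↔ f.1 x = x := by
  have h : U.equivGInf f ∈ U.groupChain.discriminant ↔ f.1 x ∈ ⋂ ℓ, U.set ℓ := by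
    rw [Set.mem_iInter]
    exact forall_congr' fun ℓ => U.equivGInf_mem_GHat_iff
  rw [h, U.iInter_eq, Set.mem_singleton_iff]

/-- `K_ℓ` consists of the elements of the closure that fix `U_ℓ` pointwise. -/
theorem equivGInf_mem_stabilizerChain_iff {ℓ : ℕ} {f : closureGroup G X} :
    U.equivGInf f ∈ U.groupChain.stabilizerChain ℓ ↔ ∀ z ∈ U.set ℓ, f.1 z = z := by
  -- `f` fixes the point `e x` of `U_ℓ` exactly when its image fixes the point `ê x_∞` of `Û_ℓ`
  have key : ∀ e : closureGroup G X,
      U.equivGInf f • U.equivGInf e • U.groupChain.basepoint =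
        U.equivGInf e • U.groupChain.basepoint ↔ f.1 (e.1 x) = e.1 x := by
    intro e
    rw [← inv_smul_eq_iff (g := U.equivGInf e), ← mul_smul, ← mul_smul, ← map_inv, ← map_mul,
      ← map_mul, ← GroupChain.mem_discriminant_iff, equivGInf_mem_discriminant_iff]
    exact Equiv.symm_apply_eq e.1
  constructor
  · intro hf z hz
    obtain ⟨e, he, rfl⟩ := exists_mem_closureGroup_apply_eq (G := G) x z
    exact (key ⟨e, he⟩).mp ((mem_fixingSubgroup_iff _).mp hf.2 _
      ⟨_, U.equivGInf_mem_GHat_iff.mpr hz, rfl⟩)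
  · intro hf
    refine ⟨U.equivGInf_mem_GHat_iff.mpr ?_, (mem_fixingSubgroup_iff _).mpr ?_⟩
    · rw [hf x (U.mem ℓ)]
      exact U.mem ℓ
    · rintro _ ⟨q, hq, rfl⟩
      obtain ⟨e, rfl⟩ := U.equivGInf.surjective q
      exact (key e).mpr (hf _ (U.equivGInf_mem_GHat_iff.mp hq))

theorem equivGInf_mem_centralizerChain_iff {ℓ : ℕ} {f : closureGroup G X} :
    U.equivGInf f ∈ U.groupChain.centralizerChain ℓ ↔
      f.1 x = x ∧ ∀ e : closureGroup G X, e.1 x ∈ U.set ℓ → f * e * f⁻¹ = e := by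
  refine and_congr U.equivGInf_mem_discriminant_iff ?_
  rw [U.equivGInf.surjective.forall]
  refine forall_congr' fun e => imp_congr U.equivGInf_mem_GHat_iff ?_
  rw [← map_mul, ← map_inv, ← map_mul, U.equivGInf.injective.eq_iff]

/-! ### Invariance of the limit groups -/

section Invariance

variable {X' : Type*} [MetricSpace X'] [MulAction G X'] [IsCantorAction G X'] {x' : X'}
  {U} {U' : AdaptedNhdBasis G x'} {F : X ≃ₜ X'} {ψ : closureGroup G X ≃* closureGroup G X'}

theorem exists_stabilizerChain_map (hF : F x = x')
    (hψ : ∀ f z, (ψ f).1 (F z) = F (f.1 z)) (i : ℕ) :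
    ∃ j, ∀ a ∈ U.groupChain.stabilizerChain i,
      U'.equivGInf (ψ (U.equivGInf.symm a)) ∈ U'.groupChain.stabilizerChain j := by
  have hN : F.symm ⁻¹' U.set i ∈ 𝓝 x' := F.symm.continuous.continuousAt.preimage_mem_nhds
    ((U.adapted i).isClopen.isOpen.mem_nhds (by rw [← hF, F.symm_apply_apply]; exact U.mem i))
  obtain ⟨j, hj⟩ := U'.exists_set_subset hN
  refine ⟨j, fun a ha => ?_⟩
  obtain ⟨f, rfl⟩ := U.equivGInf.surjective a
  rw [MulEquiv.symm_apply_apply, equivGInf_mem_stabilizerChain_iff]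
  rw [equivGInf_mem_stabilizerChain_iff] at ha
  intro z hz
  rw [← F.apply_symm_apply z, hψ, ha _ (hj hz)]

theorem exists_centralizerChain_map (hF : F x = x')
    (hψ : ∀ f z, (ψ f).1 (F z) = F (f.1 z)) (i : ℕ) :
    ∃ j, ∀ a ∈ U.groupChain.centralizerChain i,
      U'.equivGInf (ψ (U.equivGInf.symm a)) ∈ U'.groupChain.centralizerChain j := by
  have hN : F.symm ⁻¹' U.set i ∈ 𝓝 x' := F.symm.continuous.continuousAt.preimage_mem_nhds
    ((U.adapted i).isClopen.isOpen.mem_nhds (by rw [← hF, F.symm_apply_apply]; exact U.mem i))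
  obtain ⟨j, hj⟩ := U'.exists_set_subset hN
  refine ⟨j, fun a ha => ?_⟩
  obtain ⟨f, rfl⟩ := U.equivGInf.surjective a
  rw [MulEquiv.symm_apply_apply, equivGInf_mem_centralizerChain_iff]
  rw [equivGInf_mem_centralizerChain_iff] at ha
  refine ⟨by rw [← hF, hψ, ha.1], fun e he => ?_⟩
  obtain ⟨e, rfl⟩ := ψ.surjective e
  have hex := hj he
  rw [Set.mem_preimage, ← hF, hψ, F.symm_apply_apply] at hex
  rw [← map_inv, ← map_mul, ← map_mul, ha.2 e hex]

/-- A homeomorphism that matches the base points and conjugates the closures of the two groups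
induces isomorphisms of the limit groups. -/
theorem limitGroupsIso_of_conj (hF : F x = x') (hψ : ∀ f z, (ψ f).1 (F z) = F (f.1 z)) :
    U.groupChain.LimitGroupsIso U'.groupChain := by
  have hF' : F.symm x' = x := by rw [← hF, F.symm_apply_apply]
  have hψ' : ∀ f z, (ψ.symm f).1 (F.symm z) = F.symm (f.1 z) := fun f z => by
    refine F.injective ?_
    rw [← hψ, ψ.apply_symm_apply, F.apply_symm_apply, F.apply_symm_apply]
  exact GroupChain.limitGroupsIso_of_mulEquiv
    (U.equivGInf.symm.trans (ψ.trans U'.equivGInf))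
    (exists_stabilizerChain_map hF hψ)
    (exists_stabilizerChain_map (F := F.symm) (ψ := ψ.symm) hF' hψ')
    (exists_centralizerChain_map hF hψ)
    (exists_centralizerChain_map (F := F.symm) (ψ := ψ.symm) hF' hψ')

end Invariance

/-- Conjugate actions have isomorphic limit groups, for any choice of base points and of
neighborhood bases. -/
theorem limitGroupsIso_of_conjugacy {X' : Type*} [MetricSpace X'] [MulAction G X']
    [IsCantorAction G X'] (h : X ≃ₜ X') (hG : ∀ (g : G) (z : X), h (g • z) = g • h z)
    {x' : X'} (U' : AdaptedNhdBasis G x') : U.groupChain.LimitGroupsIso U'.groupChain := by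
  -- the conjugacy is corrected by an element of the closure that moves `h x` to `x'`
  obtain ⟨e, he, hex⟩ := exists_mem_closureGroup_apply_eq (G := G) (h x) x'
  let E : X' ≃ₜ X' := ⟨e, continuous_of_mem_closureGroup he,
    continuous_of_mem_closureGroup (inv_mem he)⟩
  have hGsymm : ∀ (g : G) (z : X'), h.symm (g • z) = g • h.symm z := fun g z => by
    rw [h.symm_apply_eq, hG, h.apply_symm_apply]
  let F : X ≃ₜ X' := h.trans E
  have hmap : (closureGroup G X).map F.toEquiv.permCongrHom.toMonoidHom = closureGroup G X' := by
    ext f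
    constructor
    · rintro ⟨f, hf, rfl⟩
      exact mul_mem (mul_mem he (permCongr_mem_closureGroup h hG hf)) (inv_mem he)
    · intro hf
      refine ⟨_, permCongr_mem_closureGroup h.symm hGsymm
        (mul_mem (mul_mem (inv_mem he) hf) he), Equiv.ext fun z => ?_⟩
      change e (h (h.symm (e⁻¹ (f (e (h (h.symm (e⁻¹ z)))))))) = f z
      simp
  exact limitGroupsIso_of_conj (F := F) hex
    (ψ := (F.toEquiv.permCongrHom.subgroupMap _).trans (MulEquiv.subgroupCongr hmap))
    fun f z => congrArg (fun w => F (f.1 w)) (F.symm_apply_apply z)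

end AdaptedNhdBasis

theorem theorem1p1 {G : Type*} {X : Type*} [Group G] [Countable G] [Infinite G]
    [MetricSpace X] [MulAction G X] [IsCantorAction G X] :
    -- every point has an adapted neighborhood basis, so that odometer models exist
    (∀ x : X, Nonempty (AdaptedNhdBasis G x)) ∧
    -- the two increasing chains consist of subgroups of the discriminant
    (∀ (x : X) (U : AdaptedNhdBasis G x) (ℓ : ℕ),
      U.groupChain.stabilizerChain ℓ ≤ U.groupChain.discriminant ∧
      U.groupChain.centralizerChain ℓ ≤ U.groupChain.discriminant) ∧
    -- the limit groups do not depend on the base point and on the neighborhood basis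
    (∀ (x y : X) (U : AdaptedNhdBasis G x) (V : AdaptedNhdBasis G y),
      U.groupChain.LimitGroupsIso V.groupChain) ∧
    -- the limit groups are invariants of conjugacy
    (∀ (X' : Type*) [MetricSpace X'] [MulAction G X'] [IsCantorAction G X'] (h : X ≃ₜ X'),
      (∀ (g : G) (x : X), h (g • x) = g • h x) →
      ∀ (x : X) (x' : X') (U : AdaptedNhdBasis G x) (U' : AdaptedNhdBasis G x'),
        U.groupChain.LimitGroupsIso U'.groupChain) ∧
    -- the centralizer limit group is included in the stabilizer limit group
    (∀ (x : X) (U : AdaptedNhdBasis G x),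
      (∀ ℓ, U.groupChain.centralizerChain ℓ ≤ U.groupChain.stabilizerChain ℓ) ∧
      Function.Injective U.groupChain.upsilonInclusion) := by

  refine ⟨nonempty_adaptedNhdBasis G, fun x U ℓ =>
    ⟨U.groupChain.stabilizerChain_le_discriminant ℓ, fun _ ha => ha.1⟩, fun x y U V =>
    U.limitGroupsIso_of_conjugacy (Homeomorph.refl X) (fun _ _ => rfl) V,
    fun X' _ _ _ h hG x x' U U' => U.limitGroupsIso_of_conjugacy h hG U', fun x U =>
    ⟨U.groupChain.centralizerChain_le, ChainLimit.inclusion_injective _⟩⟩
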